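/- **Theorem 4.1.** For a finite graph $G$, a coloring is any map $c:V(G)\to\{\text{white},\text{black}\}$ (adjacent vertices may have the same color). Let $$W_G(t)=\sum_{c} t^{\,w(G,c)}\in\mathbb Z[t],$$ where the sum is over all colorings and $w(G,c)$ is the number of white vertices of $G$ that have an even number of black neighbors. Let $$\mathcal T(x)=\sum_{T}\frac{W_T(t)\,x^{v(T)}}{|\mathrm{Aut}\,T|}\in\mathbb Q[t][[x]],$$ where $T$ runs over all finite non-empty rooted trees up to isomorphism, $v(T)$ is the number of vertices, and isomorphisms and automorphisms preserve the root. Let $\mathcal T_w^+$, $\mathcal T_w^-$, $\mathcal T_b$ be the series obtained from $\mathcal T$ by restricting, for every $T$, the sum that defines $W_T(t)$ to those colorings of $T$ for which, respectively: the root is white and has an even number of black children; the root is white and has an odd number of black children; the root is black. Define series $(a_i,b_i,c_i)$, $i\ge 0$, in $\mathbb Q[t,t^{-1}][[x]]$ by $(a_0,b_0,c_0)=(tx,\,x^2,\,x)$ and, for $i>0$, $$a_i=t\,x\,e^{a_{i-1}+b_{i-1}}\cosh(c_{i-1}),\qquad b_i=x\,e^{a_{i-1}+b_{i-1}}\sinh(c_{i-1}),\qquad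 c_i=x\,e^{t^{-1}a_{i-1}+t\,b_{i-1}+c_{i-1}}.$$ Then all $a_i,b_i,c_i$ have constant term $0$ in $x$ (so that the recursion makes sense), and the sequences $(a_i),(b_i),(c_i)$ converge $x$-adically to power series $a_\infty,b_\infty,c_\infty\in\mathbb Q[t][[x]]$. Moreover $$\mathcal T_w^+=a_\infty,\qquad \mathcal T_w^-=b_\infty,\qquad \mathcal T_b=c_\infty,\qquad \mathcal T=a_\infty+b_\infty+c_\infty .$$ -/

import Mathlib

open scoped Polynomial PowerSeries LaurentPolynomial

namespace BlackWhite

/-! ### Colorings and the black-white polynomial -/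

/-- A black-white coloring of a vertex set: `0` is white and `1` is black. Adjacent vertices may
receive the same color. -/
abbrev Coloring (V : Type) : Type := V → ZMod 2

open Classical in
/-- The black neighbors of `v`. -/
noncomputable def blackNeighbors {V : Type} [Fintype V] (G : SimpleGraph V) (c : Coloring V)
    (v : V) : Finset V :=
  Finset.univ.filter fun w => c w = 1 ∧ G.Adj v w

open Classical in
/-- The white vertices that have an even number of black neighbors. -/
noncomputable def evenWhites {V : Type} [Fintype V] (G : SimpleGraph V) (c : Coloring V) :
    Finset V :=
  Finset.univ.filter fun v => c v = 0 ∧ Even (blackNeighbors G c v).card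

/-- The contribution of one coloring to the black-white polynomial: a factor `t` for every
white vertex with an even number of black neighbors, and `1` for every other vertex. -/
noncomputable def coloringWeight {V : Type} [Fintype V] (G : SimpleGraph V) (c : Coloring V) :
    ℤ[X] :=
  ∏ _v ∈ evenWhites G c, Polynomial.X

open Classical in
/-- The black-white polynomial `W_G(t)`: the sum of the contributions of all colorings of `G`. -/
noncomputable def bwPoly {V : Type} [Fintype V] (G : SimpleGraph V) : ℤ[X] :=
  ∑ c : Coloring V, coloringWeight G c

open Classical in
/-- The part of the black-white polynomial that comes from the colorings with property `P`. -/
noncomputable def partialBWPoly {V : Type} [Fintype V] (G : SimpleGraph V)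
    (P : Coloring V → Prop) : ℤ[X] :=
  ∑ c : Coloring V with P c, coloringWeight G c

/-! ### Rooted trees and their isomorphism classes -/

/-- A rooted tree with vertex set `Fin n`. -/
structure RTree (n : ℕ) where
  graph : SimpleGraph (Fin n)
  isTree : graph.IsTree
  root : Fin n

instance (n : ℕ) : Finite (RTree n) :=
  Finite.of_injective (β := SimpleGraph (Fin n) × Fin n) (fun T => (T.graph, T.root)) (by
    rintro ⟨G, hG, r⟩ ⟨G', hG', r'⟩ h
    simp only [Prod.mk.injEq] at h
    obtain ⟨rfl, rfl⟩ := h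
    rfl)

/-- Isomorphisms of rooted trees: graph isomorphisms that carry the root to the root. -/
abbrev RTree.Iso {n : ℕ} (T T' : RTree n) : Type :=
  {e : T.graph ≃g T'.graph // e T.root = T'.root}

/-- Automorphisms of a rooted tree. -/
abbrev RTree.Aut {n : ℕ} (T : RTree n) : Type := RTree.Iso T T

/-- Two rooted trees are equivalent if they are isomorphic as rooted trees. -/
instance RTree.setoid (n : ℕ) : Setoid (RTree n) where
  r T T' := Nonempty (RTree.Iso T T')
  iseqv :=
    { refl := fun _ => ⟨⟨SimpleGraph.Iso.refl, rfl⟩⟩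
      symm := fun {_ _} h => h.elim fun e =>
        ⟨⟨e.1.symm, e.1.toEquiv.symm_apply_eq.mpr e.2.symm⟩⟩
      trans := fun {_ _ _} h h' => h.elim fun e => h'.elim fun e' =>
        ⟨⟨e.1.trans e'.1, (congrArg e'.1 e.2).trans e'.2⟩⟩ }

/-- Isomorphism classes of rooted trees with `n` vertices. -/
abbrev RTreeClass (n : ℕ) : Type := Quotient (RTree.setoid n)

noncomputable instance (n : ℕ) : Fintype (RTreeClass n) := Fintype.ofFinite _

/-! ### The four tree series -/

/-- The series `∑_T F(T) x^{v(T)} / |Aut T|` over all rooted trees `T` up to isomorphism, for an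
isomorphism invariant `F` with values in `ℤ[t]`. -/
noncomputable def treeSeries (F : ∀ n : ℕ, RTree n → ℤ[X]) : ℚ[X]⟦X⟧ :=
  PowerSeries.mk fun n => ∑ q : RTreeClass n,
    Polynomial.C ((Nat.card (RTree.Aut q.out) : ℚ)⁻¹) *
      (F n q.out).map (Int.castRingHom ℚ)

/-- The series `𝒯` of the black-white polynomials of all rooted trees. -/
noncomputable def seriesT : ℚ[X]⟦X⟧ :=
  treeSeries fun _ T => bwPoly T.graph

/-- The contributions to `𝒯` of the trees with a coloring such that the root is white and has an
even number of black children (the children of the root are its neighbors). -/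
noncomputable def seriesWhiteEven : ℚ[X]⟦X⟧ :=
  treeSeries fun _ T => partialBWPoly T.graph fun c =>
    c T.root = 0 ∧ Even (blackNeighbors T.graph c T.root).card

/-- The contributions to `𝒯` of the trees with a coloring such that the root is white and has an
odd number of black children. -/
noncomputable def seriesWhiteOdd : ℚ[X]⟦X⟧ :=
  treeSeries fun _ T => partialBWPoly T.graph fun c =>
    c T.root = 0 ∧ Odd (blackNeighbors T.graph c T.root).card

/-- The contributions to `𝒯` of the trees with a coloring such that the root is black. -/
noncomputable def seriesBlack : ℚ[X]⟦X⟧ :=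
  treeSeries fun _ T => partialBWPoly T.graph fun c => c T.root = 1

/-! ### Power series in `x` over `ℚ[t, t⁻¹]` -/

/-- Power series in `x` with coefficients in the Laurent polynomials `ℚ[t, t⁻¹]`. -/
abbrev LSer : Type := ℚ[T;T⁻¹]⟦X⟧

/-- The constant series `t`. -/
noncomputable def t : LSer := PowerSeries.C (LaurentPolynomial.T 1)

/-- The constant series `t⁻¹`. -/
noncomputable def tInv : LSer := PowerSeries.C (LaurentPolynomial.T (-1))

/-- The series `x`. -/
noncomputable def x : LSer := PowerSeries.X

/-- `exp f = ∑ fᵏ / k!`, by substitution of `f` in the exponential series. It is meaningful for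
`f` with constant coefficient zero. -/
noncomputable def exp (f : LSer) : LSer := (PowerSeries.exp ℚ[T;T⁻¹]).subst f

/-- `cosh f = (exp f + exp (-f)) / 2`. -/
noncomputable def cosh (f : LSer) : LSer := (1 / 2 : ℚ) • (exp f + exp (-f))

/-- `sinh f = (exp f - exp (-f)) / 2`. -/
noncomputable def sinh (f : LSer) : LSer := (1 / 2 : ℚ) • (exp f - exp (-f))

/-- Convergence of a sequence of power series in the `x`-adic topology. -/
def XAdicTendsto (u : ℕ → LSer) (f : LSer) : Prop :=
  Filter.Tendsto u Filter.atTop (@nhds LSer (Ideal.span {x}).adicTopology f)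

/-- Series with coefficients in `ℚ[t]`, viewed as series with coefficients in `ℚ[t, t⁻¹]`. -/
noncomputable def toLSer : ℚ[X]⟦X⟧ →+* LSer :=
  PowerSeries.map (Polynomial.toLaurent (R := ℚ))

end BlackWhite

/-!
By the orbit-stabilizer theorem a tree series is the exponential generating function of the labelled
rooted trees with a weight. Marking a child of the root and deleting the edge to it splits a rooted
tree into two rooted trees, so if a weight `P` is multiplicative under attaching a new child that
carries a subtree of weight `Q`, then the parts `P_d` of its series of root degree `d` satisfy
`(d + 1) P_{d+1} = P_d Q`, and summation over `d` gives `P = p x exp Q`.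

Only the factor of the root has to be modified to make the weights of the colorings multiplicative.
A white root contributes `1` or `(-1)^m`, for `m` black children, which gives the exponentials of
`𝒯_w⁺ + 𝒯_w⁻ ± 𝒯_b`; half their sum and half their difference are the equations with `cosh` and
`sinh`. A child of a black root has one more black neighbor, so that even and odd exchange their
roles in the third equation. Hence the three series are a fixed point of the recursion, whose step
is a contraction because every right-hand side has the factor `x`.
-/

namespace BlackWhite

/-! ### The exponential of a power series without constant term -/

section ExpSubst

variable {R : Type*} [CommRing R]

theorem smodEq_span_X_pow_iff {k : ℕ} {f g : R⟦X⟧} :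
    f ≡ g [SMOD Ideal.span {(PowerSeries.X : R⟦X⟧)} ^ k] ↔
      ∀ n < k, PowerSeries.coeff n f = PowerSeries.coeff n g := by
  simp only [SModEq.sub_mem, Ideal.span_singleton_pow, Ideal.mem_span_singleton,
    PowerSeries.X_pow_dvd_iff, map_sub, sub_eq_zero]

theorem X_mul_smodEq {k : ℕ} {f g : R⟦X⟧}
    (h : f ≡ g [SMOD Ideal.span {(PowerSeries.X : R⟦X⟧)} ^ k]) :
    PowerSeries.X * f ≡ PowerSeries.X * g
      [SMOD Ideal.span {(PowerSeries.X : R⟦X⟧)} ^ (k + 1)] := by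
  rw [SModEq.sub_mem, ← mul_sub, pow_succ']
  exact Ideal.mul_mem_mul (Ideal.mem_span_singleton_self _) (SModEq.sub_mem.mp h)

theorem smodEq_span_X_pow_one_iff {f g : R⟦X⟧} :
    f ≡ g [SMOD Ideal.span {(PowerSeries.X : R⟦X⟧)} ^ 1] ↔
      PowerSeries.constantCoeff f = PowerSeries.constantCoeff g := by
  rw [smodEq_span_X_pow_iff]
  simp

variable [Algebra ℚ R]

theorem coeff_exp_subst {f : R⟦X⟧} (hf : PowerSeries.constantCoeff f = 0) {n N : ℕ} (hn : n < N) :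
    PowerSeries.coeff n ((PowerSeries.exp R).subst f) =
      ∑ d ∈ Finset.range N, (d.factorial : ℚ)⁻¹ • PowerSeries.coeff n (f ^ d) := by
  rw [PowerSeries.coeff_subst' (PowerSeries.HasSubst.of_constantCoeff_zero' hf),
    finsum_eq_sum_of_support_subset (s := Finset.range N)]
  · simp only [PowerSeries.coeff_exp, algebraMap_smul, one_div]
  · intro d hd
    by_contra hNd
    have hpow : PowerSeries.coeff n (f ^ d) = 0 :=
      PowerSeries.X_pow_dvd_iff.mp (pow_dvd_pow_of_dvd (PowerSeries.X_dvd_iff.mpr hf) d) n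
        (hn.trans_le (by simpa using hNd))
    exact hd (by simp only [hpow, smul_zero])

theorem exp_subst_smodEq {f g : R⟦X⟧} (hf : PowerSeries.constantCoeff f = 0)
    (hg : PowerSeries.constantCoeff g = 0) {k : ℕ}
    (h : f ≡ g [SMOD Ideal.span {(PowerSeries.X : R⟦X⟧)} ^ k]) :
    (PowerSeries.exp R).subst f ≡ (PowerSeries.exp R).subst g
      [SMOD Ideal.span {(PowerSeries.X : R⟦X⟧)} ^ k] :=
  smodEq_span_X_pow_iff.mpr fun n hn => by
    rw [coeff_exp_subst hf n.lt_succ_self, coeff_exp_subst hg n.lt_succ_self]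
    exact Finset.sum_congr rfl fun d _ => by rw [smodEq_span_X_pow_iff.mp (h.pow d) n hn]

theorem exp_subst_X_zero_add_X_one :
    (PowerSeries.exp R).subst (MvPowerSeries.X 0 + MvPowerSeries.X 1 : MvPowerSeries (Fin 2) R) =
      (PowerSeries.exp R).subst (MvPowerSeries.X 0 : MvPowerSeries (Fin 2) R) *
        (PowerSeries.exp R).subst (MvPowerSeries.X 1 : MvPowerSeries (Fin 2) R) := by
  ext e
  have := Nat.factorial_ne_zero (e 0 + e 1)
  rw [PowerSeries.coeff_subst_X_zero_add_X_one, PowerSeries.coeff_subst_X_zero_subst_mul_X_one]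
  simp only [PowerSeries.coeff_exp]
  rw [← map_natCast (algebraMap ℚ R), ← map_mul, ← map_mul, Nat.cast_add_choose]
  congr 1
  field_simp

theorem exp_subst_add {f g : R⟦X⟧} (hf : PowerSeries.constantCoeff f = 0)
    (hg : PowerSeries.constantCoeff g = 0) :
    (PowerSeries.exp R).subst (f + g) =
      (PowerSeries.exp R).subst f * (PowerSeries.exp R).subst g := by
  have hs : MvPowerSeries.HasSubst (![f, g] : Fin 2 → R⟦X⟧) :=
    MvPowerSeries.hasSubst_of_constantCoeff_zero fun i => by
      fin_cases i
      exacts [hf, hg]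
  have hsubst (y : MvPowerSeries (Fin 2) R) (hy : MvPowerSeries.constantCoeff y = 0) :
      MvPowerSeries.subst ![f, g] ((PowerSeries.exp R).subst y) =
        (PowerSeries.exp R).subst (MvPowerSeries.subst ![f, g] y) := by
    rw [PowerSeries.subst, PowerSeries.subst,
      MvPowerSeries.subst_comp_subst_apply (PowerSeries.HasSubst.of_constantCoeff_zero hy).const hs]
  have key := congrArg (MvPowerSeries.subst ![f, g]) (exp_subst_X_zero_add_X_one (R := R))
  rwa [MvPowerSeries.subst_mul hs, hsubst _ (by simp), hsubst _ (by simp), hsubst _ (by simp),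
    MvPowerSeries.subst_add hs, MvPowerSeries.subst_X hs, MvPowerSeries.subst_X hs] at key

end ExpSubst

section HyperbolicFunctions

variable {k : ℕ} {f g : LSer}

theorem exp_mul_cosh (hf : PowerSeries.constantCoeff f = 0)
    (hg : PowerSeries.constantCoeff g = 0) :
    exp f * cosh g = (1 / 2 : ℚ) • (exp (f + g) + exp (f - g)) := by
  have hg' : PowerSeries.constantCoeff (-g) = 0 := by rw [map_neg, hg, neg_zero]
  rw [cosh, mul_smul_comm, mul_add, sub_eq_add_neg]
  exact congrArg _ (congrArg₂ _ (exp_subst_add hf hg).symm (exp_subst_add hf hg').symm)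

theorem exp_mul_sinh (hf : PowerSeries.constantCoeff f = 0)
    (hg : PowerSeries.constantCoeff g = 0) :
    exp f * sinh g = (1 / 2 : ℚ) • (exp (f + g) - exp (f - g)) := by
  have hg' : PowerSeries.constantCoeff (-g) = 0 := by rw [map_neg, hg, neg_zero]
  rw [sinh, mul_smul_comm, mul_sub, sub_eq_add_neg f]
  exact congrArg _ (congrArg₂ _ (exp_subst_add hf hg).symm (exp_subst_add hf hg').symm)

theorem cosh_smodEq (hf : PowerSeries.constantCoeff f = 0)
    (hg : PowerSeries.constantCoeff g = 0) (h : f ≡ g [SMOD Ideal.span {x} ^ k]) :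
    cosh f ≡ cosh g [SMOD Ideal.span {x} ^ k] := by
  have hexp := (exp_subst_smodEq hf hg h).add
    (exp_subst_smodEq (by rw [map_neg, hf, neg_zero]) (by rw [map_neg, hg, neg_zero]) h.neg)
  refine smodEq_span_X_pow_iff.mpr fun n hn => ?_
  rw [cosh, cosh, map_rat_smul, map_rat_smul]
  exact congrArg _ (smodEq_span_X_pow_iff.mp hexp n hn)

theorem sinh_smodEq (hf : PowerSeries.constantCoeff f = 0)
    (hg : PowerSeries.constantCoeff g = 0) (h : f ≡ g [SMOD Ideal.span {x} ^ k]) :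
    sinh f ≡ sinh g [SMOD Ideal.span {x} ^ k] := by
  have hexp := (exp_subst_smodEq hf hg h).sub
    (exp_subst_smodEq (by rw [map_neg, hf, neg_zero]) (by rw [map_neg, hg, neg_zero]) h.neg)
  refine smodEq_span_X_pow_iff.mpr fun n hn => ?_
  rw [sinh, sinh, map_rat_smul, map_rat_smul]
  exact congrArg _ (smodEq_span_X_pow_iff.mp hexp n hn)

end HyperbolicFunctions

/-! ### Joining two rooted trees by an edge between the roots -/

section Graphs

open SimpleGraph

section Join

variable {V W : Type*} {G : SimpleGraph V} {H : SimpleGraph W} {r : V} {u : W}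

/-- The graph that arises from the disjoint union of `G` and `H` by adding an edge between `r` and
`u`. It joins a tree rooted at `r` to the tree that hangs at the child `u` of `r`. -/
def join (G : SimpleGraph V) (H : SimpleGraph W) (r : V) (u : W) : SimpleGraph (V ⊕ W) :=
  (G ⊕g H) ⊔ SimpleGraph.edge (Sum.inl r) (Sum.inr u)

@[simp] theorem join_adj_inl_inl {a b : V} :
    (join G H r u).Adj (Sum.inl a) (Sum.inl b) ↔ G.Adj a b := by
  simp [join, SimpleGraph.edge_adj]

@[simp] theorem join_adj_inr_inr {a b : W} :
    (join G H r u).Adj (Sum.inr a) (Sum.inr b) ↔ H.Adj a b := by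
  simp [join, SimpleGraph.edge_adj]

@[simp] theorem join_adj_inl_inr {a : V} {b : W} :
    (join G H r u).Adj (Sum.inl a) (Sum.inr b) ↔ a = r ∧ b = u := by
  simp [join, SimpleGraph.edge_adj]

@[simp] theorem join_adj_inr_inl {a : V} {b : W} :
    (join G H r u).Adj (Sum.inr b) (Sum.inl a) ↔ a = r ∧ b = u := by
  rw [SimpleGraph.adj_comm, join_adj_inl_inr]

theorem isTree_join [Finite V] [Finite W] (hG : G.IsTree) (hH : H.IsTree) (r : V) (u : W) :
    (join G H r u).IsTree := by
  have hG' := (isTree_iff_connected_and_card.mp hG).2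
  have hH' := (isTree_iff_connected_and_card.mp hH).2
  have hedges : (join G H r u).edgeSet = insert s(Sum.inl r, Sum.inr u) (G ⊕g H).edgeSet := by
    rw [join, SimpleGraph.edgeSet_sup, Set.union_comm,
      SimpleGraph.edgeSet_edge_of_ne Sum.inl_ne_inr, Set.insert_eq]
  refine isTree_iff_connected_and_card.mpr ⟨hG.connected.sum_sup_edge hH.connected, ?_⟩
  rw [hedges, Nat.card_coe_set_eq, Set.ncard_insert_of_notMem (by simp) (Set.toFinite _),
    ← Nat.card_coe_set_eq, Nat.card_congr edgeSetSumEquiv, Nat.card_sum, Nat.card_sum]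
  omega

end Join

section UniqueCrossing

variable {V : Type*} {G : SimpleGraph V} {S S' : Set V} {r u : V}

/-- The only edge of `G` between `S` and its complement goes from `r ∈ S` to `u ∉ S`. -/
structure IsUniqueCrossing (G : SimpleGraph V) (S : Set V) (r u : V) : Prop where
  left_mem : r ∈ S
  right_notMem : u ∉ S
  adj_iff : ∀ a ∈ S, ∀ b ∉ S, G.Adj a b ↔ a = r ∧ b = u

namespace IsUniqueCrossing

theorem adj (hS : IsUniqueCrossing G S r u) : G.Adj r u :=
  (hS.adj_iff r hS.left_mem u hS.right_notMem).mpr ⟨rfl, rfl⟩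

theorem compl (hS : IsUniqueCrossing G S r u) : IsUniqueCrossing G Sᶜ u r where
  left_mem := hS.right_notMem
  right_notMem := not_not_intro hS.left_mem
  adj_iff a ha b hb := by
    rw [G.adj_comm, hS.adj_iff b (not_not.mp hb) a ha, and_comm]

theorem mem_iff_of_adj (hS : IsUniqueCrossing G S r u) {a b : V} (hab : G.Adj a b) :
    b ∈ S ↔ (a ∈ S ↔ s(a, b) ≠ s(r, u)) := by
  have hr := hS.left_mem
  have hu := hS.right_notMem
  have hcross := hS.adj_iff a
  have hcross' := hS.adj_iff b
  grind [G.adj_comm, Sym2.eq_iff]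

theorem eq (hG : G.Preconnected) (hS : IsUniqueCrossing G S r u)
    (hS' : IsUniqueCrossing G S' r u) : S = S' := by
  ext v
  have hrv := (reachable_iff_reflTransGen r v).mp (hG r v)
  induction hrv with
  | refl => exact iff_of_true hS.left_mem hS'.left_mem
  | tail _ hab ih =>
    exact (hS.mem_iff_of_adj hab).trans
      ((iff_congr ih Iff.rfl).trans (hS'.mem_iff_of_adj hab).symm)

theorem preconnected_induce (hG : G.Preconnected) (hS : IsUniqueCrossing G S r u) :
    (G.induce S).Preconnected := by
  classical
  -- Retract `V` onto `S` by collapsing the complement to `r`.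
  let f : V → S := fun v => if hv : v ∈ S then ⟨v, hv⟩ else ⟨r, hS.left_mem⟩
  have hf (a b : V) (hab : G.Adj a b) : (G.induce S).Reachable (f a) (f b) := by
    by_cases ha : a ∈ S <;> by_cases hb : b ∈ S
    · have hab' : (G.induce S).Adj ⟨a, ha⟩ ⟨b, hb⟩ := hab
      simpa only [f, dif_pos ha, dif_pos hb] using hab'.reachable
    · obtain ⟨rfl, -⟩ := (hS.adj_iff a ha b hb).mp hab
      simp only [f, dif_pos ha, dif_neg hb, Reachable.refl]
    · obtain ⟨rfl, -⟩ := (hS.adj_iff b hb a ha).mp hab.symm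
      simp only [f, dif_neg ha, dif_pos hb, Reachable.refl]
    · simp only [f, dif_neg ha, dif_neg hb, Reachable.refl]
  have hlift (v : V) : (G.induce S).Reachable (f r) (f v) := by
    have hrv := (reachable_iff_reflTransGen r v).mp (hG r v)
    induction hrv with
    | refl => rfl
    | tail _ hab ih => exact ih.trans (hf _ _ hab)
  have hfS (v : S) : f v = v := dif_pos v.2
  exact fun a b => by simpa only [hfS] using (hlift a).symm.trans (hlift b)

theorem isTree_induce (hG : G.IsTree) (hS : IsUniqueCrossing G S r u) : (G.induce S).IsTree where
  connected :=
    { preconnected := hS.preconnected_induce hG.connected.preconnected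
      nonempty := ⟨⟨r, hS.left_mem⟩⟩ }
  isAcyclic := hG.isAcyclic.induce S

end IsUniqueCrossing

theorem exists_isUniqueCrossing (hG : G.IsAcyclic) (hru : G.Adj r u) :
    ∃ S, IsUniqueCrossing G S r u := by
  have hbridge : ¬ (G.deleteEdges {s(r, u)}).Reachable r u :=
    isBridge_iff.mp (isAcyclic_iff_forall_adj_isBridge.mp hG hru)
  refine ⟨{v | (G.deleteEdges {s(r, u)}).Reachable r v}, Reachable.refl r, hbridge,
    fun a ha b hb => ⟨fun hab => ?_, by rintro ⟨rfl, rfl⟩; exact hru⟩⟩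
  have hab' : s(a, b) = s(r, u) := by
    by_contra hne
    exact hb (Reachable.trans ha (deleteEdges_adj.mpr ⟨hab, hne⟩).reachable)
  rcases Sym2.eq_iff.mp hab' with h | ⟨rfl, rfl⟩
  · exact h
  · exact absurd ha hbridge

end UniqueCrossing

section Glue

variable {V : Type*} {S : Set V} {G : SimpleGraph S} {H : SimpleGraph ↥Sᶜ} {r : S} {u : ↥Sᶜ}

open Classical in
/-- The graph `join G H r u` as a graph on `V`, for `G` and `H` on complementary subsets of `V`. -/
noncomputable def glue (G : SimpleGraph S) (H : SimpleGraph ↥Sᶜ) (r : S) (u : ↥Sᶜ) :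
    SimpleGraph V :=
  (Equiv.Set.sumCompl S).simpleGraph (join G H r u)

open Classical in
/-- The isomorphism that identifies the disjoint union of `S` and `Sᶜ` with `V`. -/
noncomputable def glueIso (G : SimpleGraph S) (H : SimpleGraph ↥Sᶜ) (r : S) (u : ↥Sᶜ) :
    join G H r u ≃g glue G H r u :=
  (Iso.comap (Equiv.Set.sumCompl S).symm (join G H r u)).symm

theorem glue_adj_iff {p q : S ⊕ ↥Sᶜ} :
    (glue G H r u).Adj (glueIso G H r u p) (glueIso G H r u q) ↔ (join G H r u).Adj p q :=
  (glueIso G H r u).map_adj_iff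

theorem glueIso_inl (a : S) : glueIso G H r u (Sum.inl a) = a := rfl

theorem glueIso_inr (a : ↥Sᶜ) : glueIso G H r u (Sum.inr a) = a := rfl

theorem isUniqueCrossing_glue : IsUniqueCrossing (glue G H r u) S r u where
  left_mem := r.2
  right_notMem := u.2
  adj_iff a ha b hb := by
    have h := glue_adj_iff (G := G) (H := H) (r := r) (u := u)
      (p := .inl ⟨a, ha⟩) (q := .inr ⟨b, hb⟩)
    rw [join_adj_inl_inr] at h
    simpa [glueIso_inl, glueIso_inr, Subtype.ext_iff] using h

theorem induce_glue : (glue G H r u).induce S = G := by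
  ext a b
  exact (glue_adj_iff (p := .inl a) (q := .inl b)).trans join_adj_inl_inl

theorem induce_compl_glue : (glue G H r u).induce Sᶜ = H := by
  ext a b
  exact (glue_adj_iff (p := .inr a) (q := .inr b)).trans join_adj_inr_inr

theorem IsUniqueCrossing.glue_induce {K : SimpleGraph V} (hS : IsUniqueCrossing K S r u) :
    glue (K.induce S) (K.induce Sᶜ) r u = K := by
  ext a b
  obtain ⟨p, rfl⟩ := (glueIso (K.induce S) (K.induce Sᶜ) r u).surjective a
  obtain ⟨q, rfl⟩ := (glueIso (K.induce S) (K.induce Sᶜ) r u).surjective b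
  rw [glue_adj_iff]
  rcases p with a | a <;> rcases q with b | b
  · exact join_adj_inl_inl
  · rw [join_adj_inl_inr, Subtype.ext_iff, Subtype.ext_iff]
    exact (hS.adj_iff a a.2 b b.2).symm
  · rw [join_adj_inr_inl, Subtype.ext_iff, Subtype.ext_iff, K.adj_comm]
    exact (hS.adj_iff b b.2 a a.2).symm
  · exact join_adj_inr_inr

end Glue

/-- A rooted tree with vertex set `V`. -/
@[ext] structure RootedTree (V : Type*) where
  graph : SimpleGraph V
  isTree : graph.IsTree
  root : V

/-- A rooted tree on `V` with a marked child of the root such that `S` is the set of the vertices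
that stay connected with the root when the edge between the root and the child is deleted. -/
@[ext] structure SplitTree {V : Type*} (S : Set V) extends RootedTree V where
  child : V
  isUniqueCrossing : IsUniqueCrossing graph S root child

section Finiteness

variable {V : Type*} [Finite V]

instance : Finite (RootedTree V) :=
  Finite.of_injective (fun T => (T.graph, T.root)) fun _ _ h =>
    RootedTree.ext (Prod.ext_iff.mp h).1 (Prod.ext_iff.mp h).2

noncomputable instance : Fintype (RootedTree V) := Fintype.ofFinite _

instance (S : Set V) : Finite (SplitTree S) :=
  Finite.of_injective (fun T => (T.toRootedTree, T.child)) fun _ _ h => by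
    simp only [Prod.ext_iff, RootedTree.ext_iff] at h
    exact SplitTree.ext h.1.1 h.1.2 h.2

noncomputable instance (S : Set V) : Fintype (SplitTree S) := Fintype.ofFinite _

end Finiteness

/-- Transport of rooted trees along a bijection of the vertex sets. -/
def RootedTree.congr {V W : Type*} (e : V ≃ W) : RootedTree V ≃ RootedTree W where
  toFun T := ⟨e.simpleGraph T.graph, (Iso.comap e.symm T.graph).isTree_iff.mpr T.isTree, e T.root⟩
  invFun T := ⟨e.symm.simpleGraph T.graph, (Iso.comap e T.graph).isTree_iff.mpr T.isTree,
    e.symm T.root⟩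
  left_inv T := RootedTree.ext (e.simpleGraph.symm_apply_apply T.graph) (e.symm_apply_apply T.root)
  right_inv T := RootedTree.ext (e.simpleGraph.apply_symm_apply T.graph) (e.apply_symm_apply T.root)

section Splitting

variable {V : Type*}

/-- Marking a child of the root amounts to choosing a split of the vertex set. -/
noncomputable def SplitTree.sigmaEquiv (V : Type*) :
    (Σ S : Set V, SplitTree S) ≃ Σ T : RootedTree V, T.graph.neighborSet T.root :=
  Equiv.ofBijective (fun p => ⟨p.2.toRootedTree, p.2.child, p.2.isUniqueCrossing.adj⟩) <| by
    constructor
    · rintro ⟨S, ⟨T, u, hS⟩⟩ ⟨S', ⟨T', u', hS'⟩⟩ h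
      obtain ⟨rfl, hu⟩ := Sigma.mk.inj_iff.mp h
      obtain rfl : u = u' := congrArg Subtype.val (eq_of_heq hu)
      obtain rfl := hS.eq T.isTree.connected.preconnected hS'
      rfl
    · rintro ⟨T, u, hu⟩
      obtain ⟨S, hS⟩ := exists_isUniqueCrossing T.isTree.isAcyclic hu
      exact ⟨⟨S, T, u, hS⟩, rfl⟩

/-- A rooted tree that is split along `S` amounts to a rooted tree on `S` and a rooted tree on the
complement of `S`, whose root is the marked child. -/
noncomputable def SplitTree.prodEquiv [Finite V] (S : Set V) :
    SplitTree S ≃ RootedTree S × RootedTree ↥Sᶜ where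
  toFun T :=
    (⟨T.graph.induce S, T.isUniqueCrossing.isTree_induce T.isTree,
        T.root, T.isUniqueCrossing.left_mem⟩,
      ⟨T.graph.induce Sᶜ, T.isUniqueCrossing.compl.isTree_induce T.isTree,
        T.child, T.isUniqueCrossing.right_notMem⟩)
  invFun p :=
    { graph := glue p.1.graph p.2.graph p.1.root p.2.root
      isTree := (glueIso _ _ _ _).isTree_iff.mp
        (isTree_join p.1.isTree p.2.isTree p.1.root p.2.root)
      root := p.1.root
      child := p.2.root
      isUniqueCrossing := isUniqueCrossing_glue }
  left_inv T := SplitTree.ext T.isUniqueCrossing.glue_induce rfl rfl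
  right_inv _ := Prod.ext (RootedTree.ext induce_glue rfl) (RootedTree.ext induce_compl_glue rfl)

theorem sum_card_neighborSet_smul [Fintype V] {M : Type*} [AddCommMonoid M] (f : RootedTree V → M) :
    ∑ T, Nat.card (T.graph.neighborSet T.root) • f T =
      ∑ S : Set V, ∑ T : SplitTree S, f T.toRootedTree := by
  have (T : RootedTree V) : Fintype (T.graph.neighborSet T.root) := Fintype.ofFinite _
  calc ∑ T, Nat.card (T.graph.neighborSet T.root) • f T
      = ∑ p : Σ T : RootedTree V, T.graph.neighborSet T.root, f p.1 := by
        simp only [Fintype.sum_sigma, Finset.sum_const, Finset.card_univ, Nat.card_eq_fintype_card]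
    _ = ∑ p : Σ S : Set V, SplitTree S, f p.2.toRootedTree :=
        ((SplitTree.sigmaEquiv V).sum_comp fun p => f p.1).symm
    _ = ∑ S : Set V, ∑ T : SplitTree S, f T.toRootedTree := Fintype.sum_sigma _

end Splitting

/-! ### The exponential formula for rooted trees -/

/-- A weight on finite rooted graphs. -/
abbrev RootedWeight (R : Type*) : Type _ := ∀ (V : Type) [Fintype V], SimpleGraph V → V → R

namespace RootedWeight

section WeightedSums

variable {R : Type*} [CommRing R] {P P' Q : RootedWeight R} {V W : Type} [Fintype V] [Fintype W]

/-- Invariance of a weight under isomorphisms. -/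
def IsInvariant (P : RootedWeight R) : Prop :=
  ∀ ⦃V W : Type⦄ [Fintype V] [Fintype W] ⦃G : SimpleGraph V⦄ ⦃H : SimpleGraph W⦄ (e : G ≃g H)
    (r : V), P W H (e r) = P V G r

/-- The weight `P` of a rooted graph with a pendant rooted graph attached to its root is the product
of the weight `P'` of the first graph and the weight `Q` of the second one. -/
def IsProduct (P P' Q : RootedWeight R) : Prop :=
  ∀ ⦃V W : Type⦄ [Fintype V] [Fintype W] (G : SimpleGraph V) (H : SimpleGraph W) (r : V) (u : W),
    P (V ⊕ W) (join G H r u) (Sum.inl r) = P' V G r * Q W H u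

/-- The sum of the weights of all rooted trees with vertex set `V`. -/
noncomputable def treeSum (P : RootedWeight R) (V : Type) [Fintype V] : R :=
  ∑ T : RootedTree V, P V T.graph T.root

theorem IsInvariant.treeSum_congr (hP : P.IsInvariant) (e : V ≃ W) : P.treeSum V = P.treeSum W :=
  Fintype.sum_equiv (RootedTree.congr e) _ _ fun T =>
    (hP (Iso.comap e.symm T.graph).symm T.root).symm

theorem treeSum_of_isEmpty [IsEmpty V] : P.treeSum V = 0 :=
  have : IsEmpty (RootedTree V) := ⟨fun T => isEmptyElim T.root⟩
  Fintype.sum_empty _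

theorem treeSum_of_unique [Unique V] : P.treeSum V = P V ⊥ default :=
  have : Subsingleton (RootedTree V) :=
    ⟨fun _ _ => RootedTree.ext (Subsingleton.elim _ _) (Subsingleton.elim _ _)⟩
  Fintype.sum_subsingleton (fun T : RootedTree V => P V T.graph T.root)
    ⟨⊥, IsTree.of_subsingleton, default⟩

theorem IsProduct.sum_splitTree (hP : P.IsInvariant) (h : P.IsProduct P' Q) (S : Set V) [Fintype S]
    [Fintype ↥Sᶜ] :
    ∑ T : SplitTree S, P V T.graph T.root = P'.treeSum S * Q.treeSum ↥Sᶜ := by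
  rw [treeSum, treeSum, Finset.sum_mul_sum, ← Fintype.sum_prod_type']
  refine Fintype.sum_equiv (SplitTree.prodEquiv S) _ _ fun T => ?_
  obtain ⟨⟨T₁, T₂⟩, rfl⟩ := (SplitTree.prodEquiv S).symm.surjective T
  rw [Equiv.apply_symm_apply, ← h T₁.graph T₂.graph T₁.root T₂.root]
  exact hP (glueIso T₁.graph T₂.graph T₁.root T₂.root) (Sum.inl T₁.root)

end WeightedSums

section RootDegree

variable {R : Type*} [CommRing R] {P P' Q : RootedWeight R}

open Classical in
/-- The restriction of a weight to the graphs with root degree `d`. -/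
noncomputable def ofDegree (P : RootedWeight R) (d : ℕ) : RootedWeight R :=
  fun V _ G r => if Nat.card (G.neighborSet r) = d then P V G r else 0

theorem IsInvariant.ofDegree (hP : P.IsInvariant) (d : ℕ) : (P.ofDegree d).IsInvariant :=
  fun V W _ _ G H e r => by
    rw [RootedWeight.ofDegree, RootedWeight.ofDegree, hP e r, Nat.card_congr (e.mapNeighborSet r)]

theorem card_neighborSet_join {V W : Type*} [Finite V] (G : SimpleGraph V) (H : SimpleGraph W)
    (r : V) (u : W) :
    Nat.card ((join G H r u).neighborSet (Sum.inl r)) = Nat.card (G.neighborSet r) + 1 := by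
  have h : (join G H r u).neighborSet (Sum.inl r) =
      insert (Sum.inr u) (Sum.inl '' G.neighborSet r) := by
    ext (a | a) <;> simp
  rw [h, Nat.card_coe_set_eq, Set.ncard_insert_of_notMem (by simp) (Set.toFinite _),
    Set.ncard_image_of_injective _ Sum.inl_injective, Nat.card_coe_set_eq]

theorem IsProduct.ofDegree (h : P.IsProduct P' Q) (d : ℕ) :
    (P.ofDegree (d + 1)).IsProduct (P'.ofDegree d) Q := fun V W _ _ G H r u => by
  simp only [RootedWeight.ofDegree, card_neighborSet_join, h G H r u, ite_mul, zero_mul,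
    Nat.add_right_cancel_iff]

theorem treeSum_eq_sum_ofDegree (P : RootedWeight R) (V : Type) [Fintype V] {N : ℕ}
    (hN : Fintype.card V < N) :
    P.treeSum V = ∑ d ∈ Finset.range N, (P.ofDegree d).treeSum V := by
  simp only [treeSum]
  rw [Finset.sum_comm]
  refine Finset.sum_congr rfl fun T _ => ?_
  have hdeg : Nat.card (T.graph.neighborSet T.root) < N :=
    ((Nat.card_coe_set_eq _).trans_le (Set.ncard_le_card _)).trans_lt
      (by rwa [Nat.card_eq_fintype_card])
  simp only [RootedWeight.ofDegree, Finset.sum_ite_eq, Finset.mem_range, hdeg, if_true]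

theorem smul_treeSum_ofDegree (P : RootedWeight R) (V : Type) [Fintype V] (d : ℕ) :
    d • (P.ofDegree d).treeSum V =
      ∑ S : Set V, ∑ T : SplitTree S, P.ofDegree d V T.graph T.root := by
  rw [← sum_card_neighborSet_smul fun T => P.ofDegree d V T.graph T.root, treeSum, Finset.smul_sum]
  refine Finset.sum_congr rfl fun T _ => ?_
  by_cases hd : Nat.card (T.graph.neighborSet T.root) = d
  · rw [hd]
  · simp only [RootedWeight.ofDegree, if_neg hd, smul_zero]

theorem treeSum_ofDegree_zero_of_nontrivial (P : RootedWeight R) (V : Type) [Fintype V]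
    [Nontrivial V] : (P.ofDegree 0).treeSum V = 0 :=
  Fintype.sum_eq_zero _ fun T => if_neg <| by
    obtain ⟨v, hv⟩ := T.isTree.connected.preconnected.exists_adj_of_nontrivial T.root
    have : Nonempty (T.graph.neighborSet T.root) := ⟨v, hv⟩
    exact Nat.card_pos.ne'

end RootDegree

section ExponentialFormula

variable {R : Type*} [CommRing R] [Algebra ℚ R] {P Q : RootedWeight R}

/-- The exponential generating function of the labelled rooted trees with a given weight. -/
noncomputable def egf : RootedWeight R →ₗ[R] R⟦X⟧ where
  toFun P := PowerSeries.mk fun n => (n.factorial : ℚ)⁻¹ • P.treeSum (Fin n)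
  map_add' P Q := by
    ext n
    simp only [treeSum, Pi.add_apply, Finset.sum_add_distrib, smul_add, PowerSeries.coeff_mk,
      map_add]
  map_smul' y P := by
    ext n
    simp only [treeSum, Pi.smul_apply, ← Finset.smul_sum, smul_comm _ y, PowerSeries.coeff_mk,
      map_smul, RingHom.id_apply]

theorem coeff_egf (P : RootedWeight R) (n : ℕ) :
    PowerSeries.coeff n (egf P) = (n.factorial : ℚ)⁻¹ • P.treeSum (Fin n) :=
  PowerSeries.coeff_mk n fun n => (n.factorial : ℚ)⁻¹ • P.treeSum (Fin n)

theorem constantCoeff_egf (P : RootedWeight R) : PowerSeries.constantCoeff (egf P) = 0 := by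
  rw [← PowerSeries.coeff_zero_eq_constantCoeff_apply, coeff_egf, treeSum_of_isEmpty, smul_zero]

open Classical in
theorem coeff_egf_mul_egf (hP : P.IsInvariant) (hQ : Q.IsInvariant) (n : ℕ) :
    PowerSeries.coeff n (egf P * egf Q) =
      (n.factorial : ℚ)⁻¹ • ∑ S : Set (Fin n), P.treeSum S * Q.treeSum ↥Sᶜ := by
  let F (k : ℕ) : R := P.treeSum (Fin k) * Q.treeSum (Fin (n - k))
  have hF (S : Set (Fin n)) : P.treeSum S * Q.treeSum ↥Sᶜ = F S.ncard := by
    have hS : Fintype.card S = S.ncard := by rw [← Nat.card_coe_set_eq, Nat.card_eq_fintype_card]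
    rw [hP.treeSum_congr (Fintype.equivFinOfCardEq hS), hQ.treeSum_congr
      (Fintype.equivFinOfCardEq (by rw [Fintype.card_compl_set, hS, Fintype.card_fin]))]
  have hsum : ∑ S : Set (Fin n), P.treeSum S * Q.treeSum ↥Sᶜ =
      ∑ k ∈ Finset.range (n + 1), n.choose k • F k := by
    simp only [hF]
    rw [← Fintype.finsetEquivSet.sum_comp, ← Finset.powerset_univ]
    simp only [Fintype.coe_finsetEquivSet, Set.ncard_coe_finset, Finset.sum_powerset_apply_card,
      Finset.card_univ, Fintype.card_fin]
  rw [hsum, PowerSeries.coeff_mul, Finset.Nat.sum_antidiagonal_eq_sum_range_succ_mk,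
    Finset.smul_sum]
  refine Finset.sum_congr rfl fun k hk => ?_
  have := Nat.factorial_ne_zero n
  rw [coeff_egf, coeff_egf, smul_mul_smul_comm, ← Nat.cast_smul_eq_nsmul ℚ, smul_smul,
    Nat.cast_choose ℚ (Finset.mem_range_succ_iff.mp hk)]
  congr 1
  field_simp

theorem IsProduct.smul_egf_ofDegree_succ (h : P.IsProduct P Q) (hP : P.IsInvariant)
    (hQ : Q.IsInvariant) (d : ℕ) :
    ((d + 1 : ℕ) : ℚ) • egf (P.ofDegree (d + 1)) = egf (P.ofDegree d) * egf Q := by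
  classical
  ext n
  rw [map_rat_smul, coeff_egf, smul_comm, Nat.cast_smul_eq_nsmul, smul_treeSum_ofDegree,
    coeff_egf_mul_egf (hP.ofDegree d) hQ]
  simp only [(h.ofDegree d).sum_splitTree (hP.ofDegree (d + 1))]

theorem egf_ofDegree_zero {p : R} (hp : P (Fin 1) ⊥ 0 = p) :
    egf (P.ofDegree 0) = PowerSeries.C p * PowerSeries.X := by
  ext n
  rw [PowerSeries.coeff_C_mul, PowerSeries.coeff_X, coeff_egf]
  rcases n with _ | _ | n
  · simp [treeSum_of_isEmpty]
  · simp [treeSum_of_unique, ofDegree, hp]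
  · simp [treeSum_ofDegree_zero_of_nontrivial]

theorem IsProduct.egf_ofDegree (h : P.IsProduct P Q) (hP : P.IsInvariant) (hQ : Q.IsInvariant)
    {p : R} (hp : P (Fin 1) ⊥ 0 = p) (d : ℕ) :
    egf (P.ofDegree d) =
      PowerSeries.C p * PowerSeries.X * ((d.factorial : ℚ)⁻¹ • egf Q ^ d) := by
  induction d with
  | zero => simp [egf_ofDegree_zero hp]
  | succ d ih =>
    have hd : ((d + 1 : ℕ) : ℚ) ≠ 0 := by positivity
    rw [← inv_smul_smul₀ hd (egf (P.ofDegree (d + 1))), h.smul_egf_ofDegree_succ hP hQ, ih,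
      mul_assoc, smul_mul_assoc, ← pow_succ, ← mul_smul_comm, smul_smul, Nat.factorial_succ,
      Nat.cast_mul, mul_inv]

theorem IsProduct.egf_eq (h : P.IsProduct P Q) (hP : P.IsInvariant) (hQ : Q.IsInvariant) {p : R}
    (hp : P (Fin 1) ⊥ 0 = p) :
    egf P = PowerSeries.C p * PowerSeries.X * (PowerSeries.exp R).subst (egf Q) := by
  ext n
  have hsum : PowerSeries.coeff n (egf P) =
      ∑ d ∈ Finset.range (n + 1), PowerSeries.coeff n (egf (P.ofDegree d)) := by
    simp only [coeff_egf]
    rw [treeSum_eq_sum_ofDegree P (Fin n) (N := n + 1) (by simp), Finset.smul_sum]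
  simp only [hsum, h.egf_ofDegree hP hQ hp, mul_assoc, PowerSeries.coeff_C_mul]
  rcases n with _ | n
  · simp
  · simp only [PowerSeries.coeff_succ_X_mul, map_rat_smul,
      coeff_exp_subst (constantCoeff_egf Q) (by omega : n < n + 1 + 1), Finset.mul_sum]

end ExponentialFormula

end RootedWeight

end Graphs

/-! ### From isomorphism classes to labelled trees -/

section OrbitSums

variable {G X M : Type*} [Group G] [MulAction G X] [Finite G] [Fintype X] [AddCommGroup M]
  [Module ℚ M]

open MulAction

theorem sum_quotient_inv_card_stabilizer_smul {s : Setoid X} [Fintype (Quotient s)]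
    (hs : s = orbitRel G X) {F : X → M} (hF : ∀ (g : G) (y : X), F (g • y) = F y) :
    ∑ q : Quotient s, (Nat.card (stabilizer G q.out) : ℚ)⁻¹ • F q.out =
      (Nat.card G : ℚ)⁻¹ • ∑ y, F y := by
  subst hs
  have (y : X) : Fintype (orbit G y) := Fintype.ofFinite _
  have horbit (y : X) : ∑ z : orbit G y, F z = Nat.card (orbit G y) • F y := by
    have hconst (z : orbit G y) : F z = F y := by
      obtain ⟨_, g, rfl⟩ := z
      exact hF g y
    simp only [hconst, Finset.sum_const, Finset.card_univ, Nat.card_eq_fintype_card]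
  have hcard (y : X) :
      (Nat.card (stabilizer G y) : ℚ)⁻¹ = (Nat.card G : ℚ)⁻¹ * Nat.card (orbit G y) := by
    have hpos : (Nat.card G : ℚ) ≠ 0 := Nat.cast_ne_zero.mpr Nat.card_pos.ne'
    have hstab : (Nat.card (stabilizer G y) : ℚ) ≠ 0 := Nat.cast_ne_zero.mpr Nat.card_pos.ne'
    have horb := Nat.card_prod (orbit G y) (stabilizer G y)
    rw [Nat.card_congr (orbitProdStabilizerEquivGroup G y)] at horb
    field_simp
    rw [horb, Nat.cast_mul, mul_comm]
  calc ∑ q : orbitRel.Quotient G X, (Nat.card (stabilizer G q.out) : ℚ)⁻¹ • F q.out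
      = (Nat.card G : ℚ)⁻¹ • ∑ q : orbitRel.Quotient G X, ∑ z : orbit G q.out, F z := by
        simp only [horbit, hcard, mul_smul, Finset.smul_sum, Nat.cast_smul_eq_nsmul]
    _ = (Nat.card G : ℚ)⁻¹ • ∑ p : Σ q : orbitRel.Quotient G X, orbit G q.out, F p.2 := by
        rw [Fintype.sum_sigma]
    _ = (Nat.card G : ℚ)⁻¹ • ∑ y, F y := by
        rw [← (selfEquivSigmaOrbits G X).symm.sum_comp]
        rfl

end OrbitSums

section Relabelling

instance {V : Type*} : MulAction (Equiv.Perm V) (RootedTree V) where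
  smul σ := RootedTree.congr σ
  one_smul _ := rfl
  mul_smul _ _ _ := rfl

/-- Rooted trees with vertex set `Fin n` in the sense of `RTree` and of `RootedTree` agree. -/
def RTree.equivRootedTree (n : ℕ) : RTree n ≃ RootedTree (Fin n) where
  toFun T := ⟨T.graph, T.isTree, T.root⟩
  invFun T := ⟨T.graph, T.isTree, T.root⟩

instance (n : ℕ) : MulAction (Equiv.Perm (Fin n)) (RTree n) :=
  (RTree.equivRootedTree n).mulAction _

variable {n : ℕ} {T T' : RTree n} {σ : Equiv.Perm (Fin n)}

theorem RTree.smul_eq_iff : σ • T = T' ↔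
    (∀ a b, T'.graph.Adj (σ a) (σ b) ↔ T.graph.Adj a b) ∧ σ T.root = T'.root := by
  rw [← (RTree.equivRootedTree n).apply_eq_iff_eq, RootedTree.ext_iff]
  refine and_congr ((Equiv.eq_symm_apply σ.simpleGraph).symm.trans ?_) Iff.rfl
  rw [SimpleGraph.ext_iff, eq_comm]
  simp only [funext_iff, eq_iff_iff]
  rfl

/-- Isomorphisms of rooted trees are the relabellings of the first tree that give the second. -/
def RTree.isoEquiv (T T' : RTree n) : RTree.Iso T T' ≃ {σ : Equiv.Perm (Fin n) // σ • T = T'} where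
  toFun e := ⟨e.1.toEquiv, RTree.smul_eq_iff.mpr ⟨fun _ _ => e.1.map_adj_iff, e.2⟩⟩
  invFun σ := ⟨⟨σ.1, (RTree.smul_eq_iff.mp σ.2).1 _ _⟩, (RTree.smul_eq_iff.mp σ.2).2⟩

theorem RTree.card_aut (T : RTree n) :
    Nat.card T.Aut = Nat.card (MulAction.stabilizer (Equiv.Perm (Fin n)) T) :=
  Nat.card_congr (RTree.isoEquiv T T)

theorem RTree.setoid_eq_orbitRel :
    RTree.setoid n = MulAction.orbitRel (Equiv.Perm (Fin n)) (RTree n) :=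
  Setoid.ext fun T T' => by
    rw [Setoid.comm', MulAction.orbitRel_apply, MulAction.mem_orbit_iff]
    exact (RTree.isoEquiv T' T).nonempty_congr.trans nonempty_subtype

end Relabelling

theorem RootedWeight.IsInvariant.sum_treeClass {R : Type*} [CommRing R] [Algebra ℚ R]
    {P : RootedWeight R} (hP : P.IsInvariant) (n : ℕ) :
    ∑ q : RTreeClass n, (Nat.card q.out.Aut : ℚ)⁻¹ • P (Fin n) q.out.graph q.out.root =
      (n.factorial : ℚ)⁻¹ • P.treeSum (Fin n) := by
  have := Fintype.ofFinite (RTree n)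
  have hsmul (σ : Equiv.Perm (Fin n)) (T : RTree n) :
      P (Fin n) (σ • T).graph (σ • T).root = P (Fin n) T.graph T.root :=
    hP (SimpleGraph.Iso.comap σ.symm T.graph).symm T.root
  simp only [RTree.card_aut]
  rw [sum_quotient_inv_card_stabilizer_smul (F := fun T : RTree n => P (Fin n) T.graph T.root)
    RTree.setoid_eq_orbitRel hsmul, Nat.card_perm, Nat.card_fin, treeSum]
  exact congrArg _ ((RTree.equivRootedTree n).sum_comp fun T => P (Fin n) T.graph T.root)

theorem toLSer_treeSeries {F : ∀ n : ℕ, RTree n → ℤ[X]} {P : RootedWeight ℚ[T;T⁻¹]}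
    (hP : P.IsInvariant)
    (hF : ∀ (n : ℕ) (T : RTree n),
      Polynomial.toLaurent ((F n T).map (Int.castRingHom ℚ)) = P (Fin n) T.graph T.root) :
    toLSer (treeSeries F) = RootedWeight.egf P := by
  ext1 n
  rw [toLSer, PowerSeries.coeff_map, treeSeries, PowerSeries.coeff_mk, map_sum,
    RootedWeight.coeff_egf, ← hP.sum_treeClass]
  exact Finset.sum_congr rfl fun q _ => by
    rw [map_mul, hF, Polynomial.toLaurent_C, LaurentPolynomial.smul_eq_C_mul]

/-! ### Colorings as root weights -/

/-- A factor for a vertex of a colored graph, depending on its color and on the number of its black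
neighbors. -/
abbrev VertexFactor (R : Type*) : Type _ := ZMod 2 → ℕ → R

section Colorings

variable {R : Type*} [CommRing R] (w : R)

/-- The factor of a vertex in the black-white polynomial with `t = w`. -/
def bwFactor : VertexFactor R := fun a m => if a = 0 ∧ Even m then w else 1

open Classical in
/-- The sum over all colorings of a rooted graph of the products of the factors of the vertices,
where the root has the factor `ρ` in place of `bwFactor w`. -/
noncomputable def coloredWeight : VertexFactor R →ₗ[R] RootedWeight R where
  toFun ρ V _ G r := ∑ c : Coloring V, ρ (c r) (blackNeighbors G c r).card *
    ∏ v ∈ Finset.univ.erase r, bwFactor w (c v) (blackNeighbors G c v).card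
  map_add' ρ σ := by
    ext V _ G r
    simp only [Pi.add_apply, add_mul, Finset.sum_add_distrib]
  map_smul' y ρ := by
    ext V _ G r
    simp only [Pi.smul_apply, smul_eq_mul, mul_assoc, Finset.mul_sum, RingHom.id_apply]

theorem coloredWeight_apply (ρ : VertexFactor R) {V : Type} [Fintype V] [DecidableEq V]
    (G : SimpleGraph V) (r : V) :
    coloredWeight w ρ V G r = ∑ c : Coloring V, ρ (c r) (blackNeighbors G c r).card *
      ∏ v ∈ Finset.univ.erase r, bwFactor w (c v) (blackNeighbors G c v).card := by
  simp only [coloredWeight, LinearMap.coe_mk, AddHom.coe_mk]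
  congr!

theorem card_blackNeighbors_iso {V W : Type} [Fintype V] [Fintype W] {G : SimpleGraph V}
    {H : SimpleGraph W} (e : G ≃g H) (c : Coloring W) (v : V) :
    (blackNeighbors H c (e v)).card = (blackNeighbors G (c ∘ e) v).card :=
  (Finset.card_equiv e.toEquiv fun u => by
    simp [blackNeighbors, e.map_adj_iff]).symm

theorem coloredWeight_isInvariant (ρ : VertexFactor R) : (coloredWeight w ρ).IsInvariant := by
  classical
  intro V W _ _ G H e r
  rw [coloredWeight_apply, coloredWeight_apply]
  refine Fintype.sum_equiv (e.toEquiv.symm.arrowCongr (Equiv.refl _)) _ _ fun c => ?_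
  change _ = ρ ((c ∘ e) r) (blackNeighbors G (c ∘ e) r).card *
    ∏ v ∈ Finset.univ.erase r, bwFactor w ((c ∘ e) v) (blackNeighbors G (c ∘ e) v).card
  simp only [← card_blackNeighbors_iso, Function.comp_apply]
  congr 1
  exact (Finset.prod_equiv e.toEquiv (by simp) fun _ _ => rfl).symm

section Join

variable {V W : Type} [Fintype V] [Fintype W] (G : SimpleGraph V) (H : SimpleGraph W) (r : V)
  (u : W) (c : Coloring V) (d : Coloring W)

open Classical in
theorem card_blackNeighbors_join_inl (v : V) :
    (blackNeighbors (join G H r u) (Sum.elim c d) (Sum.inl v)).card =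
      (blackNeighbors G c v).card + if v = r ∧ d u = 1 then 1 else 0 := by
  simp only [blackNeighbors, Finset.card_filter, Fintype.sum_sum_type, Sum.elim_inl, Sum.elim_inr,
    join_adj_inl_inl, join_adj_inl_inr]
  rw [Fintype.sum_eq_single u fun w hw => if_neg fun h => hw h.2.2]
  simp [and_comm]

open Classical in
theorem card_blackNeighbors_join_inr (v : W) :
    (blackNeighbors (join G H r u) (Sum.elim c d) (Sum.inr v)).card =
      (blackNeighbors H d v).card + if v = u ∧ c r = 1 then 1 else 0 := by
  simp only [blackNeighbors, Finset.card_filter, Fintype.sum_sum_type, Sum.elim_inl, Sum.elim_inr,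
    join_adj_inr_inr, join_adj_inr_inl]
  rw [Fintype.sum_eq_single r fun w hw => if_neg fun h => hw h.2.1, add_comm]
  simp [and_comm]

end Join

/-- When a child of color `b` with `n` black children is attached to a root of color `a` with `m`
black children, the two vertices have the factor `ρ a m * σ b n` in the resulting tree. -/
def IsChildFactor (ρ σ : VertexFactor R) : Prop :=
  ∀ (a b : ZMod 2) (m n : ℕ), ρ a (m + if b = 1 then 1 else 0) *
    bwFactor w b (n + if a = 1 then 1 else 0) = ρ a m * σ b n

variable {w} {ρ σ : VertexFactor R}

theorem IsChildFactor.isProduct (h : IsChildFactor w ρ σ) :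
    (coloredWeight w ρ).IsProduct (coloredWeight w ρ) (coloredWeight w σ) := by
  classical
  intro V W _ _ G H r u
  simp only [coloredWeight_apply]
  rw [Finset.sum_mul_sum, ← Fintype.sum_prod_type']
  refine Fintype.sum_equiv (Equiv.sumArrowEquivProdArrow V W (ZMod 2)) _ _ fun c => ?_
  obtain ⟨⟨c, d⟩, rfl⟩ := (Equiv.sumArrowEquivProdArrow V W (ZMod 2)).symm.surjective c
  rw [Equiv.apply_symm_apply, show (Equiv.sumArrowEquivProdArrow V W (ZMod 2)).symm (c, d) =
    Sum.elim c d from rfl]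
  have herase : (Finset.univ : Finset (V ⊕ W)).erase (Sum.inl r) =
      (Finset.univ.erase r).disjSum Finset.univ := by
    ext (v | v) <;> simp
  have hV : ∀ v ∈ Finset.univ.erase r, bwFactor w (c v)
      (blackNeighbors (join G H r u) (Sum.elim c d) (Sum.inl v)).card =
        bwFactor w (c v) (blackNeighbors G c v).card := fun v hv => by
    simp [card_blackNeighbors_join_inl, Finset.ne_of_mem_erase hv]
  have hW : ∀ v ∈ Finset.univ.erase u, bwFactor w (d v)
      (blackNeighbors (join G H r u) (Sum.elim c d) (Sum.inr v)).card =
        bwFactor w (d v) (blackNeighbors H d v).card := fun v hv => by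
    simp [card_blackNeighbors_join_inr, Finset.ne_of_mem_erase hv]
  rw [herase, Finset.prod_disjSum, ← Finset.mul_prod_erase Finset.univ _ (Finset.mem_univ u)]
  simp only [Sum.elim_inl, Sum.elim_inr, Finset.prod_congr rfl hV, Finset.prod_congr rfl hW]
  have hru := h (c r) (d u) (blackNeighbors G c r).card (blackNeighbors H d u).card
  simp only [card_blackNeighbors_join_inl, card_blackNeighbors_join_inr, true_and]
  rw [mul_mul_mul_comm, ← hru]
  ring

theorem coloredWeight_of_unique (ρ : VertexFactor R) (V : Type) [Fintype V] [Unique V] (r : V) :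
    coloredWeight w ρ V ⊥ r = ρ 0 0 + ρ 1 0 := by
  classical
  have hbot (c : Coloring V) : blackNeighbors ⊥ c r = ∅ := by simp [blackNeighbors]
  have hr : (Finset.univ : Finset V).erase r = ∅ := by
    rw [Finset.eq_empty_iff_forall_notMem]
    exact fun v hv => Finset.ne_of_mem_erase hv (Subsingleton.elim v r)
  simp only [coloredWeight_apply, hbot, hr, Finset.card_empty, Finset.prod_empty, mul_one]
  calc ∑ c : Coloring V, ρ (c r) 0 = ∑ a : ZMod 2, ρ a 0 :=
        Fintype.sum_equiv (Equiv.funUnique V (ZMod 2)) _ _ fun c => by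
          rw [Equiv.funUnique_apply, Subsingleton.elim r default]
    _ = ρ 0 0 + ρ 1 0 := Fin.sum_univ_two _

end Colorings

section ColoredSeries

variable {R : Type*} [CommRing R] [Algebra ℚ R] {w : R} {ρ σ : VertexFactor R}

/-- The exponential generating function of the labelled rooted trees with `coloredWeight w ρ`. -/
noncomputable def coloredSeries (w : R) : VertexFactor R →ₗ[R] R⟦X⟧ :=
  RootedWeight.egf ∘ₗ coloredWeight w

theorem constantCoeff_coloredSeries (w : R) (ρ : VertexFactor R) :
    PowerSeries.constantCoeff (coloredSeries w ρ) = 0 :=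
  RootedWeight.constantCoeff_egf _

theorem IsChildFactor.coloredSeries_eq (h : IsChildFactor w ρ σ) (hρ : ρ 0 0 + ρ 1 0 = 1) :
    coloredSeries w ρ = PowerSeries.X * (PowerSeries.exp R).subst (coloredSeries w σ) := by
  have hegf := h.isProduct.egf_eq (coloredWeight_isInvariant w ρ) (coloredWeight_isInvariant w σ)
    ((coloredWeight_of_unique ρ (Fin 1) 0).trans hρ)
  rwa [map_one, one_mul] at hegf

end ColoredSeries

section RootTypes

variable (R : Type*) [CommRing R]

/-- The indicator function of the white vertices with an even number of black neighbors. -/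
def evenWhiteFactor : VertexFactor R := fun a m => if a = 0 ∧ Even m then 1 else 0

/-- The indicator function of the white vertices with an odd number of black neighbors. -/
def oddWhiteFactor : VertexFactor R := fun a m => if a = 0 ∧ Odd m then 1 else 0

/-- The indicator function of the black vertices. -/
def blackFactor : VertexFactor R := fun a _ => if a = 1 then 1 else 0

variable {R} (w : R)

theorem zmod_two_cases (a : ZMod 2) : a = 0 ∨ a = 1 := by
  revert a
  decide

theorem bwFactor_eq :
    bwFactor w = w • evenWhiteFactor R + oddWhiteFactor R + blackFactor R := by
  ext a m
  rcases zmod_two_cases a with rfl | rfl <;> rcases Nat.even_or_odd m with hm | hm <;>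
    simp [bwFactor, evenWhiteFactor, oddWhiteFactor, blackFactor, hm, Nat.not_odd_iff_even.mpr,
      Nat.not_even_iff_odd.mpr]

theorem isChildFactor_blackFactor :
    IsChildFactor w (blackFactor R)
      (evenWhiteFactor R + w • oddWhiteFactor R + blackFactor R) := by
  intro a b m n
  rcases zmod_two_cases a with rfl | rfl <;> rcases zmod_two_cases b with rfl | rfl <;>
    rcases Nat.even_or_odd n with hn | hn <;>
    simp [bwFactor, evenWhiteFactor, oddWhiteFactor, blackFactor, hn, Nat.not_odd_iff_even.mpr,
      Nat.not_even_iff_odd.mpr]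

theorem isChildFactor_evenWhiteFactor_add_oddWhiteFactor :
    IsChildFactor w (evenWhiteFactor R + oddWhiteFactor R)
      (w • evenWhiteFactor R + oddWhiteFactor R + blackFactor R) := by
  rw [← bwFactor_eq]
  intro a b m n
  have hwhite (m : ℕ) : (evenWhiteFactor R + oddWhiteFactor R) 0 m = 1 := by
    rcases Nat.even_or_odd m with hm | hm <;>
      simp [evenWhiteFactor, oddWhiteFactor, hm, Nat.not_odd_iff_even.mpr,
        Nat.not_even_iff_odd.mpr]
  rcases zmod_two_cases a with rfl | rfl
  · simp [hwhite]
  · simp [evenWhiteFactor, oddWhiteFactor]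

theorem isChildFactor_evenWhiteFactor_sub_oddWhiteFactor :
    IsChildFactor w (evenWhiteFactor R - oddWhiteFactor R)
      (w • evenWhiteFactor R + oddWhiteFactor R - blackFactor R) := by
  intro a b m n
  have hwhite (m : ℕ) : (evenWhiteFactor R - oddWhiteFactor R) 0 m = (-1) ^ m := by
    rcases Nat.even_or_odd m with hm | hm <;>
      simp [evenWhiteFactor, oddWhiteFactor, hm, hm.neg_one_pow, Nat.not_odd_iff_even.mpr,
        Nat.not_even_iff_odd.mpr]
  rcases zmod_two_cases a with rfl | rfl
  · rw [hwhite, hwhite, bwFactor_eq]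
    rcases zmod_two_cases b with rfl | rfl <;>
      simp [evenWhiteFactor, oddWhiteFactor, blackFactor, pow_succ]
  · simp [evenWhiteFactor, oddWhiteFactor]

end RootTypes

/-! ### The functional equations of the tree series -/

section FunctionalEquations

variable {R : Type*} [CommRing R] [Algebra ℚ R] (w : R)

theorem coloredSeries_blackFactor :
    coloredSeries w (blackFactor R) = PowerSeries.X * (PowerSeries.exp R).subst
      (coloredSeries w (evenWhiteFactor R) + w • coloredSeries w (oddWhiteFactor R) +
        coloredSeries w (blackFactor R)) := by
  conv_lhs => rw [(isChildFactor_blackFactor w).coloredSeries_eq (by simp [blackFactor])]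
  rw [map_add, map_add, map_smul]

theorem coloredSeries_evenWhiteFactor_add_oddWhiteFactor :
    coloredSeries w (evenWhiteFactor R + oddWhiteFactor R) =
      PowerSeries.X * (PowerSeries.exp R).subst
        (w • coloredSeries w (evenWhiteFactor R) + coloredSeries w (oddWhiteFactor R) +
          coloredSeries w (blackFactor R)) := by
  rw [(isChildFactor_evenWhiteFactor_add_oddWhiteFactor w).coloredSeries_eq
    (by simp [evenWhiteFactor, oddWhiteFactor]), map_add, map_add, map_smul]

theorem coloredSeries_evenWhiteFactor_sub_oddWhiteFactor :
    coloredSeries w (evenWhiteFactor R - oddWhiteFactor R) =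
      PowerSeries.X * (PowerSeries.exp R).subst
        (w • coloredSeries w (evenWhiteFactor R) + coloredSeries w (oddWhiteFactor R) -
          coloredSeries w (blackFactor R)) := by
  rw [(isChildFactor_evenWhiteFactor_sub_oddWhiteFactor w).coloredSeries_eq
    (by simp [evenWhiteFactor, oddWhiteFactor]), map_sub, map_add, map_smul]

end FunctionalEquations

section TreeSeries

open LaurentPolynomial

theorem toLaurent_partialBWPoly {V : Type} [Fintype V] (G : SimpleGraph V) (r : V)
    (p : ZMod 2 → ℕ → Prop) [∀ a m, Decidable (p a m)] :
    Polynomial.toLaurent ((partialBWPoly G fun c => p (c r) (blackNeighbors G c r).card).map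
        (Int.castRingHom ℚ)) =
      coloredWeight (T 1 : ℚ[T;T⁻¹]) (fun a m => if p a m then bwFactor (T 1) a m else 0)
        V G r := by
  classical
  rw [partialBWPoly, coloredWeight_apply, Polynomial.map_sum, map_sum, Finset.sum_filter]
  refine Finset.sum_congr rfl fun c _ => ?_
  have hc : Polynomial.toLaurent ((coloringWeight G c).map (Int.castRingHom ℚ)) =
      ∏ v, bwFactor (T 1) (c v) (blackNeighbors G c v).card := by
    simp only [coloringWeight, evenWhites, bwFactor, Polynomial.map_prod, map_prod,
      Polynomial.map_X, Polynomial.toLaurent_X]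
    rw [Finset.prod_filter]
  rw [ite_mul, zero_mul, Finset.mul_prod_erase Finset.univ
    (fun v => bwFactor (T 1) (c v) (blackNeighbors G c v).card) (Finset.mem_univ r), hc]
  congr!

theorem toLSer_treeSeries_partialBWPoly (p : ZMod 2 → ℕ → Prop) [∀ a m, Decidable (p a m)]
    {ρ : VertexFactor ℚ[T;T⁻¹]} (hρ : ∀ a m, ρ a m = if p a m then bwFactor (T 1) a m else 0) :
    toLSer (treeSeries fun _ T => partialBWPoly T.graph fun c =>
      p (c T.root) (blackNeighbors T.graph c T.root).card) = coloredSeries (T 1) ρ := by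
  rw [show ρ = fun a m => if p a m then bwFactor (T 1) a m else 0 from funext₂ hρ]
  exact toLSer_treeSeries (coloredWeight_isInvariant _ _) fun _ T =>
    toLaurent_partialBWPoly T.graph T.root p

theorem toLSer_seriesWhiteEven :
    toLSer seriesWhiteEven = t * coloredSeries (T 1) (evenWhiteFactor ℚ[T;T⁻¹]) := by
  rw [t, ← PowerSeries.smul_eq_C_mul, ← map_smul]
  refine toLSer_treeSeries_partialBWPoly (fun a m => a = 0 ∧ Even m) fun a m => ?_
  by_cases h : a = 0 ∧ Even m <;> simp [evenWhiteFactor, bwFactor, h]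

theorem toLSer_seriesWhiteOdd :
    toLSer seriesWhiteOdd = coloredSeries (T 1) (oddWhiteFactor ℚ[T;T⁻¹]) :=
  toLSer_treeSeries_partialBWPoly (fun a m => a = 0 ∧ Odd m) fun a m => by
    by_cases h : a = 0 ∧ Odd m <;> simp [oddWhiteFactor, bwFactor, h]

theorem toLSer_seriesBlack :
    toLSer seriesBlack = coloredSeries (T 1) (blackFactor ℚ[T;T⁻¹]) :=
  toLSer_treeSeries_partialBWPoly (fun a _ => a = 1) fun a m => by
    by_cases h : a = 1 <;> simp [blackFactor, bwFactor, h]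

theorem seriesT_eq : seriesT = seriesWhiteEven + seriesWhiteOdd + seriesBlack := by
  have h (n : ℕ) (T : RTree n) : bwPoly T.graph =
      (partialBWPoly T.graph fun c => c T.root = 0 ∧ Even (blackNeighbors T.graph c T.root).card) +
      (partialBWPoly T.graph fun c => c T.root = 0 ∧ Odd (blackNeighbors T.graph c T.root).card) +
      partialBWPoly T.graph fun c => c T.root = 1 := by
    simp only [bwPoly, partialBWPoly, Finset.sum_filter, ← Finset.sum_add_distrib]
    refine Finset.sum_congr rfl fun c _ => ?_
    rcases zmod_two_cases (c T.root) with hc | hc <;>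
      rcases Nat.even_or_odd (blackNeighbors T.graph c T.root).card with hm | hm <;>
      simp [hc, hm, Nat.not_odd_iff_even.mpr, Nat.not_even_iff_odd.mpr]
  ext1 n
  simp only [seriesT, seriesWhiteEven, seriesWhiteOdd, seriesBlack, treeSeries, map_add,
    PowerSeries.coeff_mk, ← Finset.sum_add_distrib, h, Polynomial.map_add, mul_add]

theorem constantCoeff_toLSer_seriesWhiteEven :
    PowerSeries.constantCoeff (toLSer seriesWhiteEven) = 0 := by
  rw [toLSer_seriesWhiteEven, map_mul, constantCoeff_coloredSeries, mul_zero]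

theorem constantCoeff_toLSer_seriesWhiteOdd :
    PowerSeries.constantCoeff (toLSer seriesWhiteOdd) = 0 := by
  rw [toLSer_seriesWhiteOdd, constantCoeff_coloredSeries]

theorem constantCoeff_toLSer_seriesBlack :
    PowerSeries.constantCoeff (toLSer seriesBlack) = 0 := by
  rw [toLSer_seriesBlack, constantCoeff_coloredSeries]

end TreeSeries

section TreeSeriesEquations

theorem t_mul_tInv : t * tInv = 1 := by
  rw [tInv, t, ← map_mul, ← LaurentPolynomial.T_add, add_neg_cancel, LaurentPolynomial.T_zero,
    map_one]

theorem tInv_mul_toLSer_seriesWhiteEven :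
    tInv * toLSer seriesWhiteEven =
      coloredSeries (LaurentPolynomial.T 1) (evenWhiteFactor ℚ[T;T⁻¹]) := by
  rw [toLSer_seriesWhiteEven, ← mul_assoc, mul_comm tInv, t_mul_tInv, one_mul]

theorem toLSer_seriesBlack_eq :
    toLSer seriesBlack = x * exp (tInv * toLSer seriesWhiteEven + t * toLSer seriesWhiteOdd +
      toLSer seriesBlack) := by
  rw [tInv_mul_toLSer_seriesWhiteEven, toLSer_seriesWhiteOdd, toLSer_seriesBlack, t,
    ← PowerSeries.smul_eq_C_mul]
  exact coloredSeries_blackFactor _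

theorem tInv_mul_toLSer_seriesWhiteEven_add :
    tInv * toLSer seriesWhiteEven + toLSer seriesWhiteOdd =
      x * exp (toLSer seriesWhiteEven + toLSer seriesWhiteOdd + toLSer seriesBlack) := by
  rw [tInv_mul_toLSer_seriesWhiteEven, toLSer_seriesWhiteEven, toLSer_seriesWhiteOdd,
    toLSer_seriesBlack, t, ← PowerSeries.smul_eq_C_mul, ← map_add]
  exact coloredSeries_evenWhiteFactor_add_oddWhiteFactor _

theorem tInv_mul_toLSer_seriesWhiteEven_sub :
    tInv * toLSer seriesWhiteEven - toLSer seriesWhiteOdd =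
      x * exp (toLSer seriesWhiteEven + toLSer seriesWhiteOdd - toLSer seriesBlack) := by
  rw [tInv_mul_toLSer_seriesWhiteEven, toLSer_seriesWhiteEven, toLSer_seriesWhiteOdd,
    toLSer_seriesBlack, t, ← PowerSeries.smul_eq_C_mul, ← map_sub]
  exact coloredSeries_evenWhiteFactor_sub_oddWhiteFactor _

theorem constantCoeff_toLSer_seriesWhiteEven_add :
    PowerSeries.constantCoeff (toLSer seriesWhiteEven + toLSer seriesWhiteOdd) = 0 := by
  rw [map_add, constantCoeff_toLSer_seriesWhiteEven, constantCoeff_toLSer_seriesWhiteOdd, add_zero]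

theorem toLSer_seriesWhiteEven_eq :
    toLSer seriesWhiteEven = t * x * exp (toLSer seriesWhiteEven + toLSer seriesWhiteOdd) *
      cosh (toLSer seriesBlack) := by
  have h : x * (exp (toLSer seriesWhiteEven + toLSer seriesWhiteOdd) * cosh (toLSer seriesBlack)) =
      tInv * toLSer seriesWhiteEven := by
    rw [exp_mul_cosh constantCoeff_toLSer_seriesWhiteEven_add constantCoeff_toLSer_seriesBlack,
      mul_smul_comm, mul_add, ← tInv_mul_toLSer_seriesWhiteEven_add,
      ← tInv_mul_toLSer_seriesWhiteEven_sub]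
    module
  rw [mul_assoc, mul_assoc, h, ← mul_assoc, t_mul_tInv, one_mul]

theorem toLSer_seriesWhiteOdd_eq :
    toLSer seriesWhiteOdd = x * exp (toLSer seriesWhiteEven + toLSer seriesWhiteOdd) *
      sinh (toLSer seriesBlack) := by
  rw [mul_assoc,
    exp_mul_sinh constantCoeff_toLSer_seriesWhiteEven_add constantCoeff_toLSer_seriesBlack,
    mul_smul_comm, mul_sub, ← tInv_mul_toLSer_seriesWhiteEven_add,
    ← tInv_mul_toLSer_seriesWhiteEven_sub]
  module

end TreeSeriesEquations

/-! ### Convergence of the recursion -/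

section Convergence

theorem xAdicTendsto_of_smodEq {u : ℕ → LSer} {f : LSer}
    (h : ∀ i, u i ≡ f [SMOD Ideal.span {x} ^ (i + 1)]) : XAdicTendsto u f := by
  rw [XAdicTendsto, ((Ideal.span {x}).hasBasis_nhds_adic f).tendsto_right_iff]
  intro n _
  filter_upwards [Filter.eventually_ge_atTop n] with i hi
  have hmem : u i - f ∈ Ideal.span {x} ^ n :=
    Ideal.pow_le_pow_right (by omega) (SModEq.sub_mem.mp (h i))
  exact ⟨u i - f, hmem, add_sub_cancel _ _⟩

/-- The right-hand sides of the recursion for the triples `(aᵢ, bᵢ, cᵢ)`. -/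
noncomputable def recursionStep (f : Fin 3 → LSer) : Fin 3 → LSer :=
  ![t * x * exp (f 0 + f 1) * cosh (f 2), x * exp (f 0 + f 1) * sinh (f 2),
    x * exp (tInv * f 0 + t * f 1 + f 2)]

/-- The triple `(𝒯_w⁺, 𝒯_w⁻, 𝒯_b)`. -/
noncomputable def colorSeries : Fin 3 → LSer :=
  ![toLSer seriesWhiteEven, toLSer seriesWhiteOdd, toLSer seriesBlack]

theorem recursionStep_colorSeries : recursionStep colorSeries = colorSeries := by
  ext1 j
  fin_cases j
  exacts [toLSer_seriesWhiteEven_eq.symm, toLSer_seriesWhiteOdd_eq.symm,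
    toLSer_seriesBlack_eq.symm]

variable {k : ℕ} {f g : Fin 3 → LSer}

theorem constantCoeff_recursionStep (f : Fin 3 → LSer) (j : Fin 3) :
    PowerSeries.constantCoeff (recursionStep f j) = 0 := by
  fin_cases j <;> simp [recursionStep, x]

theorem recursionStep_smodEq (hf : ∀ j, PowerSeries.constantCoeff (f j) = 0)
    (hg : ∀ j, PowerSeries.constantCoeff (g j) = 0) (h : ∀ j, f j ≡ g j [SMOD Ideal.span {x} ^ k])
    (j : Fin 3) : recursionStep f j ≡ recursionStep g j [SMOD Ideal.span {x} ^ (k + 1)] := by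
  have hwhite : exp (f 0 + f 1) ≡ exp (g 0 + g 1) [SMOD Ideal.span {x} ^ k] :=
    exp_subst_smodEq (by simp [hf]) (by simp [hg]) ((h 0).add (h 1))
  have hblack : exp (tInv * f 0 + t * f 1 + f 2) ≡ exp (tInv * g 0 + t * g 1 + g 2)
      [SMOD Ideal.span {x} ^ k] :=
    exp_subst_smodEq (by simp [hf]) (by simp [hg])
      ((((h 0).smul tInv).add ((h 1).smul t)).add (h 2))
  fin_cases j
  · simp only [recursionStep, mul_assoc]
    exact (X_mul_smodEq (hwhite.mul (cosh_smodEq (hf 2) (hg 2) (h 2)))).smul t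
  · simp only [recursionStep, mul_assoc]
    exact X_mul_smodEq (hwhite.mul (sinh_smodEq (hf 2) (hg 2) (h 2)))
  · exact X_mul_smodEq hblack

variable {u : ℕ → Fin 3 → LSer}

theorem constantCoeff_recursion (h0 : ∀ j, PowerSeries.constantCoeff (u 0 j) = 0)
    (hu : ∀ i, u (i + 1) = recursionStep (u i)) (i : ℕ) (j : Fin 3) :
    PowerSeries.constantCoeff (u i j) = 0 := by
  cases i with
  | zero => exact h0 j
  | succ i => rw [hu, constantCoeff_recursionStep]

theorem recursion_smodEq (h0 : ∀ j, PowerSeries.constantCoeff (u 0 j) = 0)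
    (hu : ∀ i, u (i + 1) = recursionStep (u i)) (hf : recursionStep f = f) (i : ℕ) (j : Fin 3) :
    u i j ≡ f j [SMOD Ideal.span {x} ^ (i + 1)] := by
  have hf0 (j : Fin 3) : PowerSeries.constantCoeff (f j) = 0 := by
    rw [← hf, constantCoeff_recursionStep]
  induction i generalizing j with
  | zero => exact smodEq_span_X_pow_one_iff.mpr ((h0 j).trans (hf0 j).symm)
  | succ i ih =>
    rw [hu, ← hf]
    exact recursionStep_smodEq (constantCoeff_recursion h0 hu i) hf0 ih j

theorem xAdicTendsto_recursion (h0 : ∀ j, PowerSeries.constantCoeff (u 0 j) = 0)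
    (hu : ∀ i, u (i + 1) = recursionStep (u i)) (j : Fin 3) :
    XAdicTendsto (fun i => u i j) (colorSeries j) :=
  xAdicTendsto_of_smodEq fun i => recursion_smodEq h0 hu recursionStep_colorSeries i j

end Convergence

end BlackWhite

theorem theorem4p1_general
    (a b c : ℕ → BlackWhite.LSer)
    (ha0 : PowerSeries.constantCoeff (a 0) = 0)
    (hb0 : PowerSeries.constantCoeff (b 0) = 0)
    (hc0 : PowerSeries.constantCoeff (c 0) = 0)
    (ha : ∀ i : ℕ, a (i + 1) =
      BlackWhite.t * BlackWhite.x * BlackWhite.exp (a i + b i) * BlackWhite.cosh (c i))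
    (hb : ∀ i : ℕ, b (i + 1) =
      BlackWhite.x * BlackWhite.exp (a i + b i) * BlackWhite.sinh (c i))
    (hc : ∀ i : ℕ, c (i + 1) =
      BlackWhite.x * BlackWhite.exp (BlackWhite.tInv * a i + BlackWhite.t * b i + c i)) :
    (∀ i : ℕ, PowerSeries.constantCoeff (a i) = 0 ∧ PowerSeries.constantCoeff (b i) = 0 ∧
      PowerSeries.constantCoeff (c i) = 0) ∧
    ∃ aInf bInf cInf : PowerSeries (Polynomial ℚ),
      BlackWhite.XAdicTendsto a (BlackWhite.toLSer aInf) ∧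
      BlackWhite.XAdicTendsto b (BlackWhite.toLSer bInf) ∧
      BlackWhite.XAdicTendsto c (BlackWhite.toLSer cInf) ∧
      BlackWhite.seriesWhiteEven = aInf ∧
      BlackWhite.seriesWhiteOdd = bInf ∧
      BlackWhite.seriesBlack = cInf ∧
      BlackWhite.seriesT = aInf + bInf + cInf := by
  have h0 : ∀ j, PowerSeries.constantCoeff (![a 0, b 0, c 0] j) = 0 := by
    simp [Fin.forall_fin_succ, ha0, hb0, hc0]
  have hstep (i : ℕ) : ![a (i + 1), b (i + 1), c (i + 1)] =
      BlackWhite.recursionStep ![a i, b i, c i] := by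
    rw [ha, hb, hc]
    rfl
  have hconst := BlackWhite.constantCoeff_recursion (u := fun i => ![a i, b i, c i]) h0 hstep
  have hlim := BlackWhite.xAdicTendsto_recursion (u := fun i => ![a i, b i, c i]) h0 hstep
  exact ⟨fun i => ⟨hconst i 0, hconst i 1, hconst i 2⟩, BlackWhite.seriesWhiteEven,
    BlackWhite.seriesWhiteOdd, BlackWhite.seriesBlack, hlim 0, hlim 1, hlim 2, rfl, rfl, rfl,
    BlackWhite.seriesT_eq⟩

theorem theorem4p1
    (a b c : ℕ → BlackWhite.LSer)
    (ha0 : a 0 = BlackWhite.t * BlackWhite.x)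
    (hb0 : b 0 = BlackWhite.x ^ 2)
    (hc0 : c 0 = BlackWhite.x)
    (ha : ∀ i : ℕ, a (i + 1) =
      BlackWhite.t * BlackWhite.x * BlackWhite.exp (a i + b i) * BlackWhite.cosh (c i))
    (hb : ∀ i : ℕ, b (i + 1) =
      BlackWhite.x * BlackWhite.exp (a i + b i) * BlackWhite.sinh (c i))
    (hc : ∀ i : ℕ, c (i + 1) =
      BlackWhite.x * BlackWhite.exp (BlackWhite.tInv * a i + BlackWhite.t * b i + c i)) :
    -- every exponential in the recursion is taken of a series without constant term
    (∀ i : ℕ, PowerSeries.constantCoeff (a i) = 0 ∧ PowerSeries.constantCoeff (b i) = 0 ∧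
      PowerSeries.constantCoeff (c i) = 0) ∧
    ∃ aInf bInf cInf : PowerSeries (Polynomial ℚ),
      BlackWhite.XAdicTendsto a (BlackWhite.toLSer aInf) ∧
      BlackWhite.XAdicTendsto b (BlackWhite.toLSer bInf) ∧
      BlackWhite.XAdicTendsto c (BlackWhite.toLSer cInf) ∧
      BlackWhite.seriesWhiteEven = aInf ∧
      BlackWhite.seriesWhiteOdd = bInf ∧
      BlackWhite.seriesBlack = cInf ∧
      BlackWhite.seriesT = aInf + bInf + cInf :=
  theorem4p1_general a b c (by simp [ha0, BlackWhite.x]) (by simp [hb0, BlackWhite.x])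
    (by simp [hc0, BlackWhite.x]) ha hb hc
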